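/- Let $\mathcal H=\mathbb C^d$ be a finite-dimensional Hilbert space. A Lindbladian is a superoperator (a linear map on the $d\times d$ complex matrices) of the form $$\rho\mapsto -\mathrm i[H,\rho]+\sum_{\nu}\Big(V_\nu\rho V_\nu^\dagger-\tfrac12\{V_\nu^\dagger V_\nu,\rho\}\Big)$$ with $H$ Hermitian and finitely many matrices $V_\nu$. The diamond norm of a superoperator $\Phi$ is $\|\Phi\|_\diamond=\sup\{\|(\Phi\otimes\mathrm{id}_d)(X)\|_1:\ \|X\|_1\le 1\}$, where $\|\cdot\|_1$ is the trace norm, $X$ ranges over $d^2\times d^2$ matrices, and $\mathrm{id}_d$ is the identity superoperator on $d\times d$ matrices. Write $[\mathcal A,\mathcal B]=\mathcal A\mathcal B-\mathcal B\mathcal A$ and $[\mathcal A,\mathcal B,\mathcal C]=[\mathcal A,[\mathcal B,\mathcal C]]$ for superoperators. **Theorem.** Let $\mathcal L=\sum_{j=1}^m\mathcal L_j$, where $\mathcal L_1,\dots,\mathcal L_m$ are Lindbladians, and let $t>0$. Let $$\mathcal S(t)=e^{t\mathcal L_1/2}e^{t\mathcal L_2/2}\cdots e^{t\mathcal L_m/2}\;e^{t\mathcal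 L_m/2}\cdots e^{t\mathcal L_2/2}e^{t\mathcal L_1/2}$$ be the second-order product formula. Then $$\|\mathcal S(t)-e^{t\mathcal L}\|_\diamond\le\frac{t^3}{12}\sum_{j_1=1}^m\Big\|\Big[\sum_{j_3=j_1+1}^m\mathcal L_{j_3},\sum_{j_2=j_1+1}^m\mathcal L_{j_2},\mathcal L_{j_1}\Big]\Big\|_\diamond+\frac{t^3}{24}\sum_{j_1=1}^m\Big\|\Big[\mathcal L_{j_1},\mathcal L_{j_1},\sum_{j_2=j_1+1}^m\mathcal L_{j_2}\Big]\Big\|_\diamond .$$ -/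

import Mathlib

open scoped Matrix

noncomputable section

/-- Linear superoperators on the operators of a finite-dimensional system with Hilbert space
`ℂ^n`. Multiplication is composition, and `⁅Φ, Ψ⁆ = Φ * Ψ - Ψ * Φ`. -/
abbrev Superoperator (n : Type*) [Fintype n] : Type _ :=
  Module.End ℂ (Matrix n n ℂ)

/-- `Φ` is a Lindbladian: for some Hamiltonian `H = Hᴴ` and finitely many jump operators `V ν`,
`Φ ρ = -i [H, ρ] + ∑ ν, (V ν ρ (V ν)ᴴ - 1/2 {(V ν)ᴴ V ν, ρ})`. -/
def IsLindbladian {n : Type*} [Fintype n] (Φ : Superoperator n) : Prop :=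
  ∃ (H : Matrix n n ℂ) (r : ℕ) (V : Fin r → Matrix n n ℂ), H.IsHermitian ∧
    ∀ ρ : Matrix n n ℂ,
      Φ ρ = -Complex.I • (H * ρ - ρ * H) +
        ∑ ν, (V ν * ρ * (V ν)ᴴ -
          (1 / 2 : ℂ) • ((V ν)ᴴ * V ν * ρ + ρ * ((V ν)ᴴ * V ν)))

/-- The trace norm `‖X‖₁ = Tr √(Xᴴ X)`, the sum of the singular values of `X`. -/
def traceNorm {k : Type*} [Fintype k] [DecidableEq k] (X : Matrix k k ℂ) : ℝ :=
  ∑ i, Real.sqrt ((Matrix.isHermitian_conjTranspose_mul_self X).eigenvalues i)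

/-- The superoperator `Φ ⊗ id` on `ℂ^n ⊗ ℂ^a`: it acts by `Φ` on the blocks
`(i, j) ↦ X (i, x) (j, y)`, so that `(Φ ⊗ id) (A ⊗ B) = Φ A ⊗ B`. -/
def ampliation {n : Type*} [Fintype n] (Φ : Superoperator n) (a : Type*) [Fintype a] :
    Superoperator (n × a) where
  toFun X := Matrix.of fun p q => Φ (Matrix.of fun i j => X (i, p.2) (j, q.2)) p.1 q.1
  map_add' X Y := by
    ext p q
    exact congrFun (congrFun (map_add Φ (Matrix.of fun i j => X (i, p.2) (j, q.2))
      (Matrix.of fun i j => Y (i, p.2) (j, q.2))) p.1) q.1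
  map_smul' c X := by
    ext p q
    exact congrFun (congrFun (map_smul Φ c
      (Matrix.of fun i j => X (i, p.2) (j, q.2))) p.1) q.1

/-- The diamond norm `‖Φ‖_⋄ = sup {‖(Φ ⊗ id) X‖₁ : ‖X‖₁ ≤ 1}`, where `id` is the identity
superoperator of an ancilla of the same dimension as the system. -/
def diamondNorm {n : Type*} [Fintype n] [DecidableEq n] (Φ : Superoperator n) : ℝ :=
  sSup {c : ℝ | ∃ X : Matrix (n × n) (n × n) ℂ,
    traceNorm X ≤ 1 ∧ c = traceNorm (ampliation Φ n X)}

/-- The exponential `e^Φ = ∑ k, Φ ^ k / k!` of a superoperator, computed through the algebra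
isomorphism that sends `Φ` to its matrix in the basis of matrix units. -/
def superExp {n : Type*} [Fintype n] [DecidableEq n] (Φ : Superoperator n) : Superoperator n :=
  (LinearMap.toMatrixAlgEquiv (Matrix.stdBasis ℂ n n)).symm
    (NormedSpace.exp (LinearMap.toMatrixAlgEquiv (Matrix.stdBasis ℂ n n) Φ))

/-- The second-order product formula
`S(t) = (e^{tL₁/2} ⋯ e^{tLₘ/2}) (e^{tLₘ/2} ⋯ e^{tL₁/2})`. -/
def productFormula {n : Type*} [Fintype n] [DecidableEq n] {m : ℕ}
    (L : Fin m → Superoperator n) (t : ℝ) : Superoperator n :=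
  (List.ofFn fun j => superExp ((t / 2) • L j)).prod *
    (List.ofFn fun j => superExp ((t / 2) • L j)).reverse.prod

end

/-! ### Product-formula error for contraction semigroups in a Banach algebra. -/

section BanachAlgebra

open NormedSpace Set Filter Topology

variable {𝔸 : Type*} [NormedRing 𝔸] [NormedAlgebra ℝ 𝔸] [CompleteSpace 𝔸]

/-! `Φ ↦ Φ ⊗ id` is an algebra homomorphism, and the diamond norm is the operator norm of its image
on trace-normed matrices (`diamondNorm_eq_norm`). So it suffices to bound the error in a Banach
algebra whose relevant exponentials have norm at most one.

For two generators, differentiate `e^{(t-s)(A+B)} e^{sA/2} e^{sB} e^{sA/2}` in `s`. The defect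
consists of commutators of `A`, `B` with exponentials; their first-order parts cancel by symmetry,
and the remainders are quadratic in `s` with nested commutators as coefficients
(`norm_strang_sub_exp_le`). Induction on the number of generators, with `B` the sum of all but the
first, gives the general bound.

Contractivity holds because sums and ampliations of Lindbladians are Lindbladians, and `1 + εΦ` is a
Kraus map up to `O(ε²)` (`IsLindbladian.exists_traceNorm_add_smul_le`). -/

lemma hasDerivAt_exp_mul_mul_exp (B C : 𝔸) (s u : ℝ) :
    HasDerivAt (fun u : ℝ => exp (u • B) * C * exp ((s - u) • B))
      (exp (u • B) * ⁅B, C⁆ * exp ((s - u) • B)) u := by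
  have h1 := (hasDerivAt_exp_smul_const (𝕂 := ℝ) B u).mul_const C
  have h2 := (hasDerivAt_exp_smul_const' (𝕂 := ℝ) B (s - u)).scomp u
    ((hasDerivAt_id u).const_sub s)
  refine (h1.mul h2).congr_deriv ?_
  simp only [Function.comp_def, Ring.lie_def]
  simp only [mul_sub, sub_mul, neg_smul, one_smul, mul_neg, mul_assoc]
  abel

omit [CompleteSpace 𝔸] in
lemma norm_exp_mul_mul_exp_le {B C : 𝔸} (hB : ∀ s : ℝ, 0 ≤ s → ‖exp (s • B)‖ ≤ 1)
    {u v : ℝ} (hu : 0 ≤ u) (hv : 0 ≤ v) : ‖exp (u • B) * C * exp (v • B)‖ ≤ ‖C‖ := by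
  calc _ ≤ ‖exp (u • B)‖ * ‖C‖ * ‖exp (v • B)‖ := norm_mul₃_le
    _ ≤ 1 * ‖C‖ * 1 := by
        gcongr
        · exact hB u hu
        · exact hB v hv
    _ = ‖C‖ := by ring

lemma norm_exp_mul_mul_exp_sub_le {B C : 𝔸} (hB : ∀ s : ℝ, 0 ≤ s → ‖exp (s • B)‖ ≤ 1)
    {s u v : ℝ} (hu : 0 ≤ u) (huv : u ≤ v) (hv : v ≤ s) :
    ‖exp (v • B) * C * exp ((s - v) • B) - exp (u • B) * C * exp ((s - u) • B)‖
      ≤ ‖⁅B, C⁆‖ * (v - u) := by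
  refine norm_image_sub_le_of_norm_deriv_le_segment' (a := u) (b := v)
    (f := fun u : ℝ => exp (u • B) * C * exp ((s - u) • B))
    (fun x _ => (hasDerivAt_exp_mul_mul_exp B C s x).hasDerivWithinAt) (fun x hx => ?_) v
    ⟨huv, le_rfl⟩
  exact norm_exp_mul_mul_exp_le hB (hu.trans hx.1) (by linarith [hx.2])

/-- Taylor expansion of `e^{uB} A e^{(s-u)B}` about `u = 0`. The next lemma expands about `u = s`
instead, which puts the exponential on the other side of the commutator; the two linear terms can
then cancel. -/
lemma norm_exp_commutator_sub_mul_exp_le {A B : 𝔸}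
    (hB : ∀ s : ℝ, 0 ≤ s → ‖exp (s • B)‖ ≤ 1) {s : ℝ} (hs : 0 ≤ s) :
    ‖exp (s • B) * A - A * exp (s • B) - s • (⁅B, A⁆ * exp (s • B))‖
      ≤ ‖⁅B, ⁅B, A⁆⁆‖ * (s ^ 2 / 2) := by
  have key := image_norm_le_of_norm_deriv_right_le_deriv_boundary (a := 0) (b := s)
    (f := fun u : ℝ => exp (u • B) * A * exp ((s - u) • B) - A * exp (s • B)
      - u • (⁅B, A⁆ * exp (s • B)))
    (f' := fun u : ℝ => exp (u • B) * ⁅B, A⁆ * exp ((s - u) • B) - ⁅B, A⁆ * exp (s • B))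
    (B := fun u => ‖⁅B, ⁅B, A⁆⁆‖ * (u ^ 2 / 2)) (B' := fun u => ‖⁅B, ⁅B, A⁆⁆‖ * u)
  have hd (u : ℝ) := ((hasDerivAt_exp_mul_mul_exp B A s u).sub_const (A * exp (s • B))).sub
    ((hasDerivAt_id u).smul_const (⁅B, A⁆ * exp (s • B)))
  simp only [one_smul] at hd
  have := key (fun u _ => (hd u).continuousAt.continuousWithinAt)
    (fun u _ => (hd u).hasDerivWithinAt) (by simp) (fun u => ?_) (fun u hu => ?_)
    (⟨hs, le_rfl⟩ : s ∈ Icc 0 s)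
  · simpa using this
  · refine (((hasDerivAt_pow 2 u).div_const 2).const_mul _).congr_deriv ?_
    simp
  · simpa using norm_exp_mul_mul_exp_sub_le (C := ⁅B, A⁆) hB le_rfl hu.1 hu.2.le

lemma norm_exp_commutator_sub_exp_mul_le {A B : 𝔸}
    (hA : ∀ s : ℝ, 0 ≤ s → ‖exp (s • A)‖ ≤ 1) {s : ℝ} (hs : 0 ≤ s) :
    ‖exp (s • A) * B - B * exp (s • A) - s • (exp (s • A) * ⁅A, B⁆)‖
      ≤ ‖⁅A, ⁅A, B⁆⁆‖ * (s ^ 2 / 2) := by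
  have key := image_norm_le_of_norm_deriv_right_le_deriv_boundary (a := 0) (b := s)
    (f := fun u : ℝ => exp (u • A) * B * exp ((s - u) • A) - B * exp (s • A)
      - u • (exp (s • A) * ⁅A, B⁆))
    (f' := fun u : ℝ => exp (u • A) * ⁅A, B⁆ * exp ((s - u) • A) - exp (s • A) * ⁅A, B⁆)
    (B := fun u => ‖⁅A, ⁅A, B⁆⁆‖ * (s * u - u ^ 2 / 2))
    (B' := fun u => ‖⁅A, ⁅A, B⁆⁆‖ * (s - u))
  have hd (u : ℝ) := ((hasDerivAt_exp_mul_mul_exp A B s u).sub_const (B * exp (s • A))).sub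
    ((hasDerivAt_id u).smul_const (exp (s • A) * ⁅A, B⁆))
  simp only [one_smul] at hd
  have := key (fun u _ => (hd u).continuousAt.continuousWithinAt)
    (fun u _ => (hd u).hasDerivWithinAt) (by simp) (fun u => ?_) (fun u hu => ?_)
    (⟨hs, le_rfl⟩ : s ∈ Icc 0 s)
  · have h2 : s * s - s ^ 2 / 2 = s ^ 2 / 2 := by ring
    simpa [h2] using this
  · refine ((((hasDerivAt_id u).const_mul s).sub
      ((hasDerivAt_pow 2 u).div_const 2)).const_mul _).congr_deriv ?_
    simp
  · have := norm_exp_mul_mul_exp_sub_le (C := ⁅A, B⁆) hA hu.1 hu.2.le le_rfl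
    rw [norm_sub_rev]
    simpa using this

/-- The error of the two-term symmetric product formula. -/
lemma norm_strang_sub_exp_le {A B : 𝔸} (hA : ∀ s : ℝ, 0 ≤ s → ‖exp (s • A)‖ ≤ 1)
    (hB : ∀ s : ℝ, 0 ≤ s → ‖exp (s • B)‖ ≤ 1)
    (hAB : ∀ s : ℝ, 0 ≤ s → ‖exp (s • (A + B))‖ ≤ 1) {t : ℝ} (ht : 0 ≤ t) :
    ‖exp ((t / 2) • A) * exp (t • B) * exp ((t / 2) • A) - exp (t • (A + B))‖
      ≤ t ^ 3 / 12 * ‖⁅B, ⁅B, A⁆⁆‖ + t ^ 3 / 24 * ‖⁅A, ⁅A, B⁆⁆‖ := by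
  -- The defect `S' - (A + B) S` of `S = e^{sA/2} e^{sB} e^{sA/2}`. The two subtracted linear terms
  -- contribute nothing in total, since `⁅A, B⁆ + ⁅B, A⁆ = 0`.
  set R : ℝ → 𝔸 := fun s =>
    ((exp ((s / 2) • A) * B - B * exp ((s / 2) • A)
        - (s / 2) • (exp ((s / 2) • A) * ⁅A, B⁆)) * exp (s • B)
      + (1 / 2 : ℝ) • (exp ((s / 2) • A) *
        (exp (s • B) * A - A * exp (s • B) - s • (⁅B, A⁆ * exp (s • B))))) * exp ((s / 2) • A)
    with hR
  have hd (s : ℝ) : HasDerivAt (fun s : ℝ => exp ((t - s) • (A + B)) *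
      (exp ((s / 2) • A) * exp (s • B) * exp ((s / 2) • A)))
      (exp ((t - s) • (A + B)) * R s) s := by
    have h0 := (hasDerivAt_exp_smul_const (𝕂 := ℝ) (A + B) (t - s)).scomp s
      ((hasDerivAt_id s).const_sub t)
    have h1 := (hasDerivAt_exp_smul_const' (𝕂 := ℝ) A (s / 2)).scomp s
      ((hasDerivAt_id s).div_const 2)
    have h2 := hasDerivAt_exp_smul_const' (𝕂 := ℝ) B s
    have hc : exp ((s / 2) • A) * A = A * exp ((s / 2) • A) := by
      exact ((Commute.refl A).smul_right (s / 2)).exp_right.eq.symm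
    have hc' (X : 𝔸) : exp ((s / 2) • A) * (A * X) = A * (exp ((s / 2) • A) * X) := by
      rw [← mul_assoc, hc, mul_assoc]
    refine (h0.mul ((h1.mul h2).mul h1)).congr_deriv ?_
    simp only [Function.comp_def, hR, Ring.lie_def, id, Pi.mul_apply]
    simp only [mul_sub, sub_mul, mul_add, add_mul, neg_smul, one_smul, neg_mul, smul_sub,
      smul_mul_assoc, mul_smul_comm, mul_assoc, hc']
    module
  -- `s²/8` is `(s/2)²/2`, and `s²/4` is half of `s²/2`; integrating gives `t³/24` and `t³/12`.
  have hbound (s : ℝ) (hs : 0 ≤ s) :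
      ‖R s‖ ≤ ‖⁅A, ⁅A, B⁆⁆‖ * (s ^ 2 / 8) + ‖⁅B, ⁅B, A⁆⁆‖ * (s ^ 2 / 4) := by
    have hs2 : 0 ≤ s / 2 := by positivity
    have e1 := norm_exp_commutator_sub_exp_mul_le (B := B) hA hs2
    have e2 := norm_exp_commutator_sub_mul_exp_le (A := A) hB hs
    have a1 := hA _ hs2
    have b1 := hB _ hs
    have nm {x y : 𝔸} {c : ℝ} (hx : ‖x‖ ≤ c) (hy : ‖y‖ ≤ 1) : ‖x * y‖ ≤ c :=
      (norm_mul_le _ _).trans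
        ((mul_le_mul hx hy (norm_nonneg _) ((norm_nonneg _).trans hx)).trans_eq (mul_one c))
    have nm' {x y : 𝔸} {c : ℝ} (hx : ‖x‖ ≤ 1) (hy : ‖y‖ ≤ c) : ‖x * y‖ ≤ c :=
      (norm_mul_le _ _).trans
        ((mul_le_mul hx hy (norm_nonneg _) zero_le_one).trans_eq (one_mul c))
    refine nm ((norm_add_le _ _).trans (add_le_add ((nm e1 b1).trans_eq (by ring)) ?_)) a1
    rw [norm_smul]
    refine (mul_le_mul_of_nonneg_left (nm' a1 e2) (norm_nonneg _)).trans_eq ?_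
    norm_num
    ring
  have key := image_norm_le_of_norm_deriv_right_le_deriv_boundary (a := 0) (b := t)
    (B := fun s => ‖⁅A, ⁅A, B⁆⁆‖ * (s ^ 3 / 24) + ‖⁅B, ⁅B, A⁆⁆‖ * (s ^ 3 / 12))
    (B' := fun s => ‖⁅A, ⁅A, B⁆⁆‖ * (s ^ 2 / 8) + ‖⁅B, ⁅B, A⁆⁆‖ * (s ^ 2 / 4))
    (fun s _ => ((hd s).sub_const (exp (t • (A + B)))).continuousAt.continuousWithinAt)
    (fun s _ => ((hd s).sub_const (exp (t • (A + B)))).hasDerivWithinAt) (by simp)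
    (fun s => ?_) (fun s hs => ?_) (⟨ht, le_rfl⟩ : t ∈ Icc 0 t)
  · simp only [sub_self, zero_smul, exp_zero, one_mul] at key
    refine key.trans_eq (by ring)
  · refine ((((hasDerivAt_pow 3 s).div_const 24).const_mul _).add
      (((hasDerivAt_pow 3 s).div_const 12).const_mul _)).congr_deriv ?_
    simp
    ring
  · refine (norm_mul_le _ _).trans ?_
    refine (mul_le_mul (hAB _ (by linarith [hs.2])) (hbound s hs.1) (norm_nonneg _)
      zero_le_one).trans_eq (one_mul _)

/-- The error of the symmetric product formula for generators all of whose partial sums generate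
contraction semigroups. -/
theorem norm_symmetric_product_sub_exp_le {m : ℕ} (A : Fin m → 𝔸)
    (hA : ∀ (S : Finset (Fin m)) (s : ℝ), 0 ≤ s → ‖exp (s • ∑ j ∈ S, A j)‖ ≤ 1)
    {t : ℝ} (ht : 0 ≤ t) :
    ‖(List.ofFn fun j => exp ((t / 2) • A j)).prod *
        (List.ofFn fun j => exp ((t / 2) • A j)).reverse.prod - exp (t • ∑ j, A j)‖ ≤
      t ^ 3 / 12 * ∑ i, ‖⁅∑ k ∈ Finset.Ioi i, A k, ⁅∑ j ∈ Finset.Ioi i, A j, A i⁆⁆‖ +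
        t ^ 3 / 24 * ∑ i, ‖⁅A i, ⁅A i, ∑ j ∈ Finset.Ioi i, A j⁆⁆‖ := by
  induction m with
  | zero => simp
  | succ m ih =>
    have ih := ih (fun j => A j.succ) fun S s hs => by
      simpa using hA (S.map (Fin.succEmb m)) s hs
    have h0 : ∀ s : ℝ, 0 ≤ s → ‖exp (s • A 0)‖ ≤ 1 := fun s hs => by
      simpa using hA {0} s hs
    have h1 : ∀ s : ℝ, 0 ≤ s → ‖exp (s • ∑ j : Fin m, A j.succ)‖ ≤ 1 := fun s hs => by
      simpa using hA (Finset.univ.map (Fin.succEmb m)) s hs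
    have h2 : ∀ s : ℝ, 0 ≤ s → ‖exp (s • (A 0 + ∑ j : Fin m, A j.succ))‖ ≤ 1 := fun s hs => by
      simpa [Fin.sum_univ_succ] using hA Finset.univ s hs
    have hstrang := norm_strang_sub_exp_le h0 h1 h2 ht
    have i0 : Finset.Ioi (0 : Fin (m + 1)) = Finset.univ.map (Fin.succEmb m) := by
      ext i
      simp
    have is (i : Fin m) : Finset.Ioi i.succ = (Finset.Ioi i).map (Fin.succEmb m) := by
      simp
    set P := (List.ofFn fun j : Fin m => exp ((t / 2) • A j.succ)).prod *
        (List.ofFn fun j : Fin m => exp ((t / 2) • A j.succ)).reverse.prod with hP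
    have hprod : (List.ofFn fun j => exp ((t / 2) • A j)).prod *
        (List.ofFn fun j => exp ((t / 2) • A j)).reverse.prod =
        exp ((t / 2) • A 0) * P * exp ((t / 2) • A 0) := by
      simp [List.ofFn_succ, hP, mul_assoc]
    -- The inner error survives multiplication by contractions without growing; what remains is a
    -- two-term error.
    have hsplit : exp ((t / 2) • A 0) * P * exp ((t / 2) • A 0) -
          exp (t • (A 0 + ∑ j : Fin m, A j.succ)) =
        exp ((t / 2) • A 0) * (P - exp (t • ∑ j : Fin m, A j.succ)) * exp ((t / 2) • A 0) +
        (exp ((t / 2) • A 0) * exp (t • ∑ j : Fin m, A j.succ) * exp ((t / 2) • A 0) -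
          exp (t • (A 0 + ∑ j : Fin m, A j.succ))) := by
      simp only [mul_sub, sub_mul]
      abel
    have ht2 : 0 ≤ t / 2 := by positivity
    rw [hprod, Fin.sum_univ_succ, hsplit]
    refine (norm_add_le _ _).trans ((add_le_add
      ((norm_exp_mul_mul_exp_le h0 ht2 ht2).trans ih) hstrang).trans_eq ?_)
    simp only [Fin.sum_univ_succ, i0, is, Finset.sum_map, Fin.coe_succEmb]
    ring

/-- An element whose exponential is contractive to first order generates a contraction
semigroup. -/
theorem norm_exp_smul_le_one_of_norm_one_add_smul_le {a : 𝔸} {c : ℝ}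
    (h : ∀ ε : ℝ, 0 ≤ ε → ‖1 + ε • a‖ ≤ 1 + c * ε ^ 2) {s : ℝ} (hs : 0 ≤ s) :
    ‖exp (s • a)‖ ≤ 1 := by
  -- Split `[0, s]` into `k` steps of length `ε`. Each costs at most `1 + 2δε`: one `δε` from the
  -- derivative at zero, one from `c ε²`.
  have key (δ : ℝ) (hδ : 0 < δ) : ‖exp (s • a)‖ ≤ Real.exp (2 * δ * s) := by
    have hd := hasDerivAt_exp_smul_const (𝕂 := ℝ) a 0
    rw [hasDerivAt_iff_isLittleO] at hd
    have e1 := hd.bound hδ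
    have e2 : ∀ᶠ ε : ℝ in 𝓝 0, c * ε < δ := by
      have : Tendsto (fun ε : ℝ => c * ε) (𝓝 0) (𝓝 0) := by
        simpa using (continuous_const_mul c).tendsto (0 : ℝ)
      exact this.eventually_lt_const hδ
    have hlim : Tendsto (fun k : ℕ => s / (k : ℝ)) atTop (𝓝 0) :=
      tendsto_const_div_atTop_nhds_zero_nat s
    obtain ⟨k, ⟨hk1, hk2⟩, hk⟩ :=
      ((hlim.eventually (e1.and e2)).and (eventually_gt_atTop 0)).exists
    have hk' : (0 : ℝ) < k := by exact_mod_cast hk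
    set ε := s / (k : ℝ) with hε
    have hε0 : 0 ≤ ε := by positivity
    simp only [zero_smul, exp_zero, one_mul, sub_zero, Real.norm_of_nonneg hε0] at hk1
    have hstep : ‖exp (ε • a)‖ ≤ Real.exp (2 * δ * ε) := by
      calc ‖exp (ε • a)‖ = ‖(exp (ε • a) - 1 - ε • a) + (1 + ε • a)‖ := by congr 1; abel
        _ ≤ δ * ε + (1 + c * ε ^ 2) := (norm_add_le _ _).trans (add_le_add hk1 (h ε hε0))
        _ ≤ 2 * δ * ε + 1 := by nlinarith
        _ ≤ _ := Real.add_one_le_exp _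
    have hsk : s • a = k • (ε • a) := by
      rw [← Nat.cast_smul_eq_nsmul ℝ, smul_smul, hε, mul_div_cancel₀ _ hk'.ne']
    let : NormedAlgebra ℚ 𝔸 := .restrictScalars ℚ ℝ 𝔸
    rw [hsk, exp_nsmul]
    refine (norm_pow_le' _ hk).trans ((pow_le_pow_left₀ (norm_nonneg _) hstep k).trans_eq ?_)
    rw [← Real.exp_nat_mul]
    congr 1
    rw [hε]
    field_simp
  have hlim : Tendsto (fun δ : ℝ => Real.exp (2 * δ * s)) (𝓝[>] 0) (𝓝 1) := by
    have : Continuous fun δ : ℝ => Real.exp (2 * δ * s) := by fun_prop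
    simpa using (this.tendsto 0).mono_left nhdsWithin_le_nhds
  exact ge_of_tendsto hlim (eventually_mem_nhdsWithin.mono key)

end BanachAlgebra

/-! ### Trace-norm duality, Kraus maps and first-order contractivity. -/

section TraceNorm

open scoped Matrix.Norms.L2Operator InnerProductSpace ComplexOrder

variable {k : Type*} [Fintype k] [DecidableEq k]

lemma Matrix.trace_eq_sum_inner_toEuclideanCLM (M : Matrix k k ℂ)
    (b : OrthonormalBasis k ℂ (EuclideanSpace ℂ k)) :
    M.trace = ∑ i, ⟪b i, toEuclideanCLM (𝕜 := ℂ) M (b i)⟫_ℂ := by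
  have h := LinearMap.trace_eq_sum_inner (toEuclideanLin M) b
  rw [toEuclideanLin, toLpLin_eq_toLin, Matrix.trace_toLin_eq] at h
  exact h

lemma Matrix.inner_toEuclideanCLM_left (M : Matrix k k ℂ) (x y : EuclideanSpace ℂ k) :
    ⟪toEuclideanCLM (𝕜 := ℂ) M x, y⟫_ℂ = ⟪x, toEuclideanCLM (𝕜 := ℂ) Mᴴ y⟫_ℂ := by
  rw [← Matrix.star_eq_conjTranspose, map_star, ContinuousLinearMap.star_eq_adjoint,
    ContinuousLinearMap.adjoint_inner_right]

lemma Matrix.inner_toEuclideanCLM_eigenvectorBasis (X : Matrix k k ℂ) (i j : k) :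
    ⟪toEuclideanCLM (𝕜 := ℂ) X ((isHermitian_conjTranspose_mul_self X).eigenvectorBasis i),
        toEuclideanCLM (𝕜 := ℂ) X ((isHermitian_conjTranspose_mul_self X).eigenvectorBasis j)⟫_ℂ =
      if i = j then ((isHermitian_conjTranspose_mul_self X).eigenvalues j : ℂ) else 0 := by
  set h := isHermitian_conjTranspose_mul_self X
  have e : toEuclideanCLM (𝕜 := ℂ) (Xᴴ * X) (h.eigenvectorBasis j) =
      (h.eigenvalues j : ℂ) • h.eigenvectorBasis j := by
    have := h.mulVec_eigenvectorBasis j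
    apply (WithLp.ofLp_injective 2)
    rw [ofLp_toEuclideanCLM, this]
    rfl
  rw [inner_toEuclideanCLM_left, ← mul_apply_eq_comp, ← map_mul, e, inner_smul_right,
    h.eigenvectorBasis.inner_eq_ite]
  simp

lemma Matrix.norm_toEuclideanCLM_eigenvectorBasis (X : Matrix k k ℂ) (i : k) :
    ‖toEuclideanCLM (𝕜 := ℂ) X ((isHermitian_conjTranspose_mul_self X).eigenvectorBasis i)‖ =
      √((isHermitian_conjTranspose_mul_self X).eigenvalues i) := by
  rw [@norm_eq_sqrt_re_inner ℂ, inner_toEuclideanCLM_eigenvectorBasis]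
  simp

/-- In an eigenbasis of `Xᴴ X`, the vectors `X vᵢ` have the singular values as norms. With the next
lemma, this makes the trace norm dual to the operator norm. -/
lemma norm_trace_mul_le (Y X : Matrix k k ℂ) : ‖(Y * X).trace‖ ≤ ‖Y‖ * traceNorm X := by
  set h := Matrix.isHermitian_conjTranspose_mul_self X
  rw [Matrix.trace_eq_sum_inner_toEuclideanCLM _ h.eigenvectorBasis, traceNorm, Finset.mul_sum]
  refine norm_sum_le_of_le _ fun i _ => ?_
  rw [map_mul, mul_apply_eq_comp]
  refine (norm_inner_le_norm _ _).trans ?_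
  rw [h.eigenvectorBasis.norm_eq_one, one_mul, ← Matrix.norm_toEuclideanCLM_eigenvectorBasis]
  exact ContinuousLinearMap.le_opNorm _ _

lemma exists_trace_mul_eq_traceNorm (X : Matrix k k ℂ) :
    ∃ Y : Matrix k k ℂ, ‖Y‖ ≤ 1 ∧ (Y * X).trace = traceNorm X := by
  set h := Matrix.isHermitian_conjTranspose_mul_self X with hh
  set v := h.eigenvectorBasis with hv
  set T := Matrix.toEuclideanCLM (𝕜 := ℂ) X with hT
  set σ : k → ℝ := fun i => √(h.eigenvalues i) with hσ
  have hσ2 (i : k) : (h.eigenvalues i : ℂ) = (σ i : ℂ) ^ 2 := by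
    rw [← Complex.ofReal_pow, Real.sq_sqrt
      ((Matrix.posSemidef_conjTranspose_mul_self X).eigenvalues_nonneg i)]
  have hin (i j : k) : ⟪T (v i), T (v j)⟫_ℂ = if i = j then (σ j : ℂ) ^ 2 else 0 := by
    rw [← hσ2]
    exact Matrix.inner_toEuclideanCLM_eigenvectorBasis X i j
  -- Left singular vectors; `u j = 0` when `σ j = 0`. The witness `W` sends `u j` to `v j`: it is
  -- the adjoint of the polar partial isometry, and Bessel's inequality bounds its norm by one.
  set u : k → EuclideanSpace ℂ k := fun j => ((σ j : ℂ)⁻¹) • T (v j) with hu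
  set W : EuclideanSpace ℂ k →L[ℂ] EuclideanSpace ℂ k :=
    ∑ j, InnerProductSpace.rankOne ℂ (v j) (u j) with hW
  have hWx (x : EuclideanSpace ℂ k) : W x = ∑ j, ⟪u j, x⟫_ℂ • v j := by
    simp [hW]
  have hWT (i : k) : W (T (v i)) = (σ i : ℂ) • v i := by
    rw [hWx, Finset.sum_eq_single i]
    · rw [hu, inner_smul_left, hin]
      by_cases h0 : (σ i : ℂ) = 0
      · simp [h0]
      · simp only [if_true, map_inv₀, Complex.conj_ofReal]
        congr 1
        field_simp
    · intro j _ hj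
      rw [hu, inner_smul_left, hin, if_neg hj]
      simp
    · simp
  refine ⟨(Matrix.toEuclideanCLM (n := k) (𝕜 := ℂ)).symm W, ?_, ?_⟩
  · rw [← Matrix.l2_opNorm_toEuclideanCLM, StarAlgEquiv.apply_symm_apply]
    refine ContinuousLinearMap.opNorm_le_bound _ zero_le_one fun x => ?_
    have hinner (j : k) : ⟪v j, W x⟫_ℂ = ⟪u j, x⟫_ℂ := by
      simp [hWx, v.inner_eq_ite]
    have hu0 (j : k) (hj : ⟪u j, x⟫_ℂ ≠ 0) : σ j ≠ 0 := fun h0 => hj (by simp [hu, h0])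
    have huo : Orthonormal ℂ fun j : {j // σ j ≠ 0} => u j := by
      rw [orthonormal_iff_ite]
      intro i j
      have hi : (σ i : ℂ) ≠ 0 := by exact_mod_cast i.2
      rw [inner_smul_left, inner_smul_right, hin]
      by_cases hij : i = j
      · subst hij
        simp only [if_true, map_inv₀, Complex.conj_ofReal]
        field_simp
      · simp [hij, Subtype.coe_inj]
    rw [one_mul, ← sq_le_sq₀ (norm_nonneg _) (norm_nonneg _), ← v.sum_sq_norm_inner_right]
    simp only [hinner]
    refine le_trans (le_of_eq ?_) (huo.sum_inner_products_le (s := Finset.univ) x)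
    rw [← Finset.sum_subtype (Finset.univ.filter fun j => σ j ≠ 0) (by simp)
      (fun j => ‖⟪u j, x⟫_ℂ‖ ^ 2), Finset.sum_filter_of_ne]
    exact fun j _ hj => hu0 j fun h0 => hj (by simp [h0])
  · rw [Matrix.trace_eq_sum_inner_toEuclideanCLM _ v, map_mul, StarAlgEquiv.apply_symm_apply,
      traceNorm, Complex.ofReal_sum]
    refine Finset.sum_congr rfl fun i _ => ?_
    rw [mul_apply_eq_comp, hWT, inner_smul_right, v.inner_eq_ite]
    simp [hσ]

lemma traceNorm_le {X : Matrix k k ℂ} {c : ℝ}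
    (h : ∀ Y : Matrix k k ℂ, ‖Y‖ ≤ 1 → ‖(Y * X).trace‖ ≤ c) : traceNorm X ≤ c := by
  obtain ⟨Y, hY, e⟩ := exists_trace_mul_eq_traceNorm X
  have := h Y hY
  rw [e, Complex.norm_real] at this
  exact (le_abs_self _).trans this

lemma traceNorm_nonneg (X : Matrix k k ℂ) : 0 ≤ traceNorm X :=
  Finset.sum_nonneg fun _ _ => Real.sqrt_nonneg _

lemma norm_trace_mul_le_of_norm_le_one {Y : Matrix k k ℂ} (hY : ‖Y‖ ≤ 1) (X : Matrix k k ℂ) :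
    ‖(Y * X).trace‖ ≤ traceNorm X :=
  (norm_trace_mul_le Y X).trans (mul_le_of_le_one_left (traceNorm_nonneg X) hY)

lemma traceNorm_add_le (X Z : Matrix k k ℂ) : traceNorm (X + Z) ≤ traceNorm X + traceNorm Z :=
  traceNorm_le fun Y hY => by
    rw [mul_add, Matrix.trace_add]
    exact norm_add_le_of_le (norm_trace_mul_le_of_norm_le_one hY X)
      (norm_trace_mul_le_of_norm_le_one hY Z)

lemma traceNorm_smul (c : ℂ) (X : Matrix k k ℂ) : traceNorm (c • X) = ‖c‖ * traceNorm X := by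
  apply le_antisymm
  · refine traceNorm_le fun Y hY => ?_
    rw [mul_smul_comm, Matrix.trace_smul, norm_smul]
    gcongr
    exact norm_trace_mul_le_of_norm_le_one hY X
  · obtain ⟨Y, hY, e⟩ := exists_trace_mul_eq_traceNorm X
    have := norm_trace_mul_le_of_norm_le_one hY (c • X)
    rwa [mul_smul_comm, Matrix.trace_smul, norm_smul, e, Complex.norm_real,
      Real.norm_of_nonneg (traceNorm_nonneg X)] at this

lemma traceNorm_eq_zero_iff (X : Matrix k k ℂ) : traceNorm X = 0 ↔ X = 0 := by
  constructor
  · intro h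
    have := norm_trace_mul_le Xᴴ X
    rw [h, mul_zero, norm_le_zero_iff] at this
    exact Matrix.trace_conjTranspose_mul_self_eq_zero_iff.mp this
  · rintro rfl
    simpa using traceNorm_smul 0 (0 : Matrix k k ℂ)

lemma sum_norm_sq_toEuclideanCLM_le {ι : Type*} [Fintype ι] (K : ι → Matrix k k ℂ)
    (x : EuclideanSpace ℂ k) :
    ∑ i, ‖Matrix.toEuclideanCLM (𝕜 := ℂ) (K i) x‖ ^ 2 ≤ ‖∑ i, (K i)ᴴ * K i‖ * ‖x‖ ^ 2 := by
  have e : ((∑ i, ‖Matrix.toEuclideanCLM (𝕜 := ℂ) (K i) x‖ ^ 2 : ℝ) : ℂ) =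
      ⟪x, Matrix.toEuclideanCLM (𝕜 := ℂ) (∑ i, (K i)ᴴ * K i) x⟫_ℂ := by
    rw [map_sum, sum_apply, inner_sum]
    push_cast
    refine Finset.sum_congr rfl fun i _ => ?_
    rw [map_mul, mul_apply_eq_comp, ← Matrix.inner_toEuclideanCLM_left,
      inner_self_eq_norm_sq_to_K]
    rfl
  have hn : ‖((∑ i, ‖Matrix.toEuclideanCLM (𝕜 := ℂ) (K i) x‖ ^ 2 : ℝ) : ℂ)‖ =
      ∑ i, ‖Matrix.toEuclideanCLM (𝕜 := ℂ) (K i) x‖ ^ 2 := by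
    rw [Complex.norm_real, Real.norm_of_nonneg (by positivity)]
  rw [← hn, e]
  calc _ ≤ ‖x‖ * (‖∑ i, (K i)ᴴ * K i‖ * ‖x‖) := by
        refine (norm_inner_le_norm _ _).trans ?_
        gcongr
        exact ContinuousLinearMap.le_opNorm _ _
    _ = _ := by ring

/-- The dual of a Kraus map with Kraus operators `K i` is bounded in operator norm by
`‖∑ i, (K i)ᴴ * K i‖`. -/
lemma norm_sum_conjTranspose_mul_mul_le {ι : Type*} [Fintype ι] (K : ι → Matrix k k ℂ)
    (Y : Matrix k k ℂ) : ‖∑ i, (K i)ᴴ * Y * K i‖ ≤ ‖Y‖ * ‖∑ i, (K i)ᴴ * K i‖ := by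
  set L := Matrix.toEuclideanCLM (n := k) (𝕜 := ℂ)
  set c := ‖∑ i, (K i)ᴴ * K i‖
  rw [← Matrix.l2_opNorm_toEuclideanCLM]
  refine ContinuousLinearMap.opNorm_le_bound _ (by positivity) fun x => ?_
  set y := L (∑ i, (K i)ᴴ * Y * K i) x with hy
  -- Cauchy–Schwarz over the Kraus index, applied to `⟪y, y⟫` with one `y` expanded.
  have hle : ‖y‖ ^ 2 ≤ (‖Y‖ * c * ‖x‖) * ‖y‖ := by
    have e : ⟪y, y⟫_ℂ = ∑ i, ⟪L (K i) y, L Y (L (K i) x)⟫_ℂ := by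
      nth_rewrite 2 [hy]
      rw [map_sum, sum_apply, inner_sum]
      refine Finset.sum_congr rfl fun i _ => ?_
      rw [map_mul, map_mul, mul_apply_eq_comp, mul_apply_eq_comp,
        ← Matrix.inner_toEuclideanCLM_left]
    calc ‖y‖ ^ 2 = ‖⟪y, y⟫_ℂ‖ := by simp
      _ ≤ ∑ i, ‖Y‖ * (‖L (K i) y‖ * ‖L (K i) x‖) := by
          rw [e]
          refine norm_sum_le_of_le _ fun i _ => (norm_inner_le_norm _ _).trans ?_
          calc _ ≤ ‖L (K i) y‖ * (‖Y‖ * ‖L (K i) x‖) := by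
                gcongr
                exact ContinuousLinearMap.le_opNorm (L Y) _
            _ = _ := by ring
      _ ≤ ‖Y‖ * (√(∑ i, ‖L (K i) y‖ ^ 2) * √(∑ i, ‖L (K i) x‖ ^ 2)) := by
          rw [← Finset.mul_sum]
          gcongr
          exact Real.sum_mul_le_sqrt_mul_sqrt _ _ _
      _ ≤ ‖Y‖ * (√(c * ‖y‖ ^ 2) * √(c * ‖x‖ ^ 2)) := by
          gcongr
          · exact sum_norm_sq_toEuclideanCLM_le K y
          · exact sum_norm_sq_toEuclideanCLM_le K x
      _ = _ := by
          have hc : 0 ≤ c := norm_nonneg _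
          rw [Real.sqrt_mul hc, Real.sqrt_mul hc, Real.sqrt_sq (norm_nonneg _),
            Real.sqrt_sq (norm_nonneg _)]
          linear_combination ‖Y‖ * ‖x‖ * ‖y‖ * Real.mul_self_sqrt hc
  rcases (norm_nonneg y).eq_or_lt with h0 | h0
  · rw [← h0]
    positivity
  · rw [sq] at hle
    exact le_of_mul_le_mul_right hle h0

/-- A Kraus map with Kraus operators `K i` is bounded in trace norm by `‖∑ i, (K i)ᴴ * K i‖`. -/
lemma traceNorm_sum_mul_mul_conjTranspose_le {ι : Type*} [Fintype ι] (K : ι → Matrix k k ℂ)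
    (X : Matrix k k ℂ) :
    traceNorm (∑ i, K i * X * (K i)ᴴ) ≤ ‖∑ i, (K i)ᴴ * K i‖ * traceNorm X :=
  traceNorm_le fun Y hY => by
    have e : (Y * ∑ i, K i * X * (K i)ᴴ).trace = ((∑ i, (K i)ᴴ * Y * K i) * X).trace := by
      rw [Finset.mul_sum, Finset.sum_mul, Matrix.trace_sum, Matrix.trace_sum]
      refine Finset.sum_congr rfl fun i _ => ?_
      rw [← mul_assoc, Matrix.trace_mul_comm]
      simp only [mul_assoc]
    rw [e]
    refine (norm_trace_mul_le _ _).trans ?_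
    gcongr
    · exact traceNorm_nonneg X
    · exact (norm_sum_conjTranspose_mul_mul_le K Y).trans
        (mul_le_of_le_one_left (norm_nonneg _) hY)

/-- With `Φ X = K X + X Kᴴ + ∑ V X Vᴴ`, the Kraus operators `1 + εK` and `√ε V` reproduce `X + ε Φ
X` up to `ε² K X Kᴴ`. Since `K + Kᴴ = -∑ Vᴴ V`, their normalization is `1 + ε² Kᴴ K`. Each of these
two corrections costs `ε² ‖K‖²`. -/
lemma IsLindbladian.exists_traceNorm_add_smul_le {Φ : Superoperator k} (hΦ : IsLindbladian Φ) :
    ∃ c : ℝ, 0 ≤ c ∧ ∀ ε : ℝ, 0 ≤ ε → ∀ X : Matrix k k ℂ,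
      traceNorm (X + (ε : ℂ) • Φ X) ≤ (1 + c * ε ^ 2) * traceNorm X := by
  obtain ⟨H, r, V, hH, hΦ⟩ := hΦ
  set G := ∑ ν, (V ν)ᴴ * V ν with hG
  have hGh : Gᴴ = G := by simp [hG, Matrix.conjTranspose_sum]
  set K := -Complex.I • H - (1 / 2 : ℂ) • G with hK
  have hKh : Kᴴ = Complex.I • H - (1 / 2 : ℂ) • G := by
    simp [hK, hGh, hH.eq]
  have hΦ' (X : Matrix k k ℂ) : Φ X = K * X + X * Kᴴ + ∑ ν, V ν * X * (V ν)ᴴ := by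
    rw [hΦ, Finset.sum_sub_distrib, ← Finset.smul_sum, Finset.sum_add_distrib, ← Finset.sum_mul,
      ← Finset.mul_sum, ← hG, hKh, hK]
    simp only [sub_mul, mul_sub, smul_mul_assoc, mul_smul_comm]
    module
  refine ⟨2 * ‖K‖ ^ 2, by positivity, fun ε hε X => ?_⟩
  set F : Option (Fin r) → Matrix k k ℂ :=
    fun o => o.elim (1 + (ε : ℂ) • K) fun ν => ((√ε : ℝ) : ℂ) • V ν with hF
  have hsq : ((√ε : ℝ) : ℂ) * ((√ε : ℝ) : ℂ) = ε := by
    rw [← Complex.ofReal_mul, Real.mul_self_sqrt hε]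
  have h1 : X + (ε : ℂ) • Φ X = (∑ o, F o * X * (F o)ᴴ) - (ε : ℂ) ^ 2 • (K * X * Kᴴ) := by
    rw [hΦ', Fintype.sum_option]
    simp only [hF, Option.elim, Matrix.conjTranspose_add, Matrix.conjTranspose_smul,
      Matrix.conjTranspose_one, smul_mul_assoc, mul_smul_comm, smul_smul, add_mul, mul_add,
      one_mul, mul_one, Complex.star_def, Complex.conj_ofReal, hsq, ← Finset.smul_sum]
    module
  have h2 : ∑ o, (F o)ᴴ * F o = 1 + (ε : ℂ) ^ 2 • (Kᴴ * K) := by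
    have hGs : ∑ ν, (V ν)ᴴ * V ν = -K - Kᴴ := by
      rw [← hG, hKh, hK]
      module
    rw [Fintype.sum_option]
    simp only [hF, Option.elim, Matrix.conjTranspose_add, Matrix.conjTranspose_smul,
      Matrix.conjTranspose_one, smul_mul_assoc, mul_smul_comm, smul_smul, add_mul, mul_add,
      one_mul, mul_one, Complex.star_def, Complex.conj_ofReal, hsq, ← Finset.smul_sum, hGs]
    module
  have h3 : ‖∑ o, (F o)ᴴ * F o‖ ≤ 1 + ε ^ 2 * ‖K‖ ^ 2 := by
    rw [h2]
    refine norm_add_le_of_le ?_ ?_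
    · rw [← Matrix.l2_opNorm_toEuclideanCLM, map_one]
      exact ContinuousLinearMap.norm_id_le
    · rw [norm_smul, Matrix.l2_opNorm_conjTranspose_mul_self]
      simp [sq]
  have h4 : traceNorm (K * X * Kᴴ) ≤ ‖K‖ ^ 2 * traceNorm X := by
    have := traceNorm_sum_mul_mul_conjTranspose_le (fun _ : Unit => K) X
    simpa [Matrix.l2_opNorm_conjTranspose_mul_self, ← sq] using this
  have hX := traceNorm_nonneg X
  have h5 := traceNorm_sum_mul_mul_conjTranspose_le F X
  rw [h1, sub_eq_add_neg, ← neg_smul]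
  refine (traceNorm_add_le _ _).trans ?_
  rw [traceNorm_smul]
  have h6 : ‖-(ε : ℂ) ^ 2‖ = ε ^ 2 := by simp
  rw [h6]
  calc _ ≤ (1 + ε ^ 2 * ‖K‖ ^ 2) * traceNorm X + ε ^ 2 * (‖K‖ ^ 2 * traceNorm X) := by
        gcongr
        exact h5.trans (by gcongr)
    _ = _ := by ring

end TraceNorm

/-! ### Stability of Lindbladians under sums and ampliation. -/

section Lindbladian

variable {n : Type*} [Fintype n]

lemma IsLindbladian.zero : IsLindbladian (0 : Superoperator n) :=
  ⟨0, 0, fun _ => 0, Matrix.isHermitian_zero, fun ρ => by simp⟩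

lemma IsLindbladian.add {Φ Ψ : Superoperator n} (hΦ : IsLindbladian Φ) (hΨ : IsLindbladian Ψ) :
    IsLindbladian (Φ + Ψ) := by
  obtain ⟨H, r, V, hH, hΦ⟩ := hΦ
  obtain ⟨H', r', V', hH', hΨ⟩ := hΨ
  refine ⟨H + H', r + r', Fin.append V V', hH.add hH', fun ρ => ?_⟩
  rw [LinearMap.add_apply, hΦ, hΨ, Fin.sum_univ_add]
  simp only [Fin.append_left, Fin.append_right, add_mul, mul_add, smul_sub, smul_add]
  abel

lemma IsLindbladian.sum {ι : Type*} {S : Finset ι} {L : ι → Superoperator n}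
    (hL : ∀ j ∈ S, IsLindbladian (L j)) : IsLindbladian (∑ j ∈ S, L j) :=
  Finset.sum_induction L IsLindbladian (fun _ _ => IsLindbladian.add) IsLindbladian.zero hL

/-- The block of an operator on `ℂ^n ⊗ ℂ^a` at a pair of ancilla indices. -/
def ancillaBlock {a : Type*} (x y : a) : Matrix (n × a) (n × a) ℂ →ₗ[ℂ] Matrix n n ℂ where
  toFun X := Matrix.of fun i j => X (i, x) (j, y)
  map_add' _ _ := rfl
  map_smul' _ _ := rfl

variable {a : Type*} [Fintype a]

omit [Fintype n] [Fintype a] in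
lemma ancillaBlock_apply (x y : a) (X : Matrix (n × a) (n × a) ℂ) (i j : n) :
    ancillaBlock x y X i j = X (i, x) (j, y) :=
  rfl

omit [Fintype n] [Fintype a] in
lemma ext_ancillaBlock {X Y : Matrix (n × a) (n × a) ℂ}
    (h : ∀ x y, ancillaBlock x y X = ancillaBlock x y Y) : X = Y := by
  ext ⟨i, x⟩ ⟨j, y⟩
  exact congrFun (congrFun (h x y) i) j

lemma ancillaBlock_ampliation (Φ : Superoperator n) (x y : a) (X : Matrix (n × a) (n × a) ℂ) :
    ancillaBlock x y (ampliation Φ a X) = Φ (ancillaBlock x y X) :=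
  rfl

open scoped Kronecker

variable [DecidableEq a]

lemma ancillaBlock_kronecker_one_mul (A : Matrix n n ℂ) (x y : a)
    (X : Matrix (n × a) (n × a) ℂ) :
    ancillaBlock x y ((A ⊗ₖ (1 : Matrix a a ℂ)) * X) = A * ancillaBlock x y X := by
  ext i j
  simp [ancillaBlock_apply, Matrix.mul_apply, Fintype.sum_prod_type, Matrix.one_apply]

lemma ancillaBlock_mul_kronecker_one (A : Matrix n n ℂ) (x y : a)
    (X : Matrix (n × a) (n × a) ℂ) :
    ancillaBlock x y (X * (A ⊗ₖ (1 : Matrix a a ℂ))) = ancillaBlock x y X * A := by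
  ext i j
  simp [ancillaBlock_apply, Matrix.mul_apply, Fintype.sum_prod_type, Matrix.one_apply]

/-- Tensoring `H` and each `V ν` with the identity works, because such factors act blockwise on the
ancilla blocks. -/
lemma IsLindbladian.ampliation {Φ : Superoperator n} (hΦ : IsLindbladian Φ) :
    IsLindbladian (ampliation Φ a) := by
  obtain ⟨H, r, V, hH, hΦ⟩ := hΦ
  refine ⟨H ⊗ₖ 1, r, fun ν => V ν ⊗ₖ 1, ?_, fun X => ext_ancillaBlock fun x y => ?_⟩
  · rw [Matrix.IsHermitian, Matrix.conjTranspose_kronecker, hH.eq, Matrix.conjTranspose_one]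
  · rw [ancillaBlock_ampliation, hΦ]
    simp only [map_add, map_sub, map_smul, map_sum, Matrix.conjTranspose_kronecker,
      Matrix.conjTranspose_one, mul_assoc, ancillaBlock_kronecker_one_mul,
      ancillaBlock_mul_kronecker_one]
    simp only [← mul_assoc, ancillaBlock_mul_kronecker_one]

/-- Ampliation as a homomorphism of algebras. -/
def ampliationAlgHom (n a : Type*) [Fintype n] [Fintype a] :
    Superoperator n →ₐ[ℂ] Superoperator (n × a) :=
  AlgHom.ofLinearMap
    { toFun := fun Φ => ampliation Φ a
      map_add' := fun _ _ => rfl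
      map_smul' := fun _ _ => rfl } rfl fun _ _ => rfl

end Lindbladian

/-! ### The diamond norm as an operator norm. -/

section DiamondNorm

variable (k : Type*) [Fintype k] [DecidableEq k]

/-- The space of matrices, to be normed by the trace norm. -/
def TraceClass (k : Type*) : Type _ := Matrix k k ℂ

instance : AddCommGroup (TraceClass k) := inferInstanceAs (AddCommGroup (Matrix k k ℂ))

instance : Module ℂ (TraceClass k) := inferInstanceAs (Module ℂ (Matrix k k ℂ))

noncomputable instance : Norm (TraceClass k) := ⟨fun X => traceNorm (k := k) X⟩

lemma TraceClass.normedSpaceCore : NormedSpace.Core ℂ (TraceClass k) where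
  norm_nonneg := traceNorm_nonneg (k := k)
  norm_smul := traceNorm_smul (k := k)
  norm_triangle := traceNorm_add_le (k := k)
  norm_eq_zero_iff := traceNorm_eq_zero_iff (k := k)

noncomputable instance : NormedAddCommGroup (TraceClass k) :=
  NormedAddCommGroup.ofCore (TraceClass.normedSpaceCore k)

noncomputable instance : NormedSpace ℂ (TraceClass k) :=
  NormedSpace.ofCore (TraceClass.normedSpaceCore k)

instance : FiniteDimensional ℂ (TraceClass k) :=
  inferInstanceAs (FiniteDimensional ℂ (Matrix k k ℂ))

instance : CompleteSpace (TraceClass k) := FiniteDimensional.complete ℂ _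

/-- Superoperators as bounded operators for the trace norm. -/
noncomputable def superoperatorToCLM :
    Superoperator k →ₐ[ℂ] (TraceClass k →L[ℂ] TraceClass k) :=
  AlgHomClass.toAlgHom (Module.End.toContinuousLinearMap (TraceClass k))

variable (n : Type*) [Fintype n] [DecidableEq n]

/-- `Φ ↦ Φ ⊗ id`, with values in the bounded operators for the trace norm. -/
noncomputable def diamondAlgHom :
    Superoperator n →ₐ[ℂ] (TraceClass (n × n) →L[ℂ] TraceClass (n × n)) :=
  (superoperatorToCLM (n × n)).comp (ampliationAlgHom n n)

variable {n}

lemma diamondNorm_eq_norm (Φ : Superoperator n) : diamondNorm Φ = ‖diamondAlgHom n Φ‖ := by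
  rw [← ContinuousLinearMap.sSup_unitClosedBall_eq_norm]
  refine congrArg sSup (Set.ext fun c => ?_)
  simp only [Set.mem_ofPred_eq, Set.mem_image, mem_closedBall_zero_iff]
  exact ⟨fun ⟨X, hX, h⟩ => ⟨X, hX, h.symm⟩, fun ⟨X, hX, h⟩ => ⟨X, hX, h.symm⟩⟩

-- Continuous algebra homomorphisms commute with the exponential, and linear maps out of a
-- finite-dimensional space are continuous.
open scoped Matrix.Norms.L2Operator in
lemma diamondAlgHom_superExp (Φ : Superoperator n) :
    diamondAlgHom n (superExp Φ) = NormedSpace.exp (diamondAlgHom n Φ) := by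
  set f := (diamondAlgHom n).comp
    (LinearMap.toMatrixAlgEquiv (Matrix.stdBasis ℂ n n)).symm.toAlgHom with hf
  have hc : Continuous f := f.toLinearMap.continuous_of_finiteDimensional
  let : NormedAlgebra ℚ (Matrix (n × n) (n × n) ℂ) := .restrictScalars ℚ ℂ _
  let : NormedAlgebra ℚ (TraceClass (n × n) →L[ℂ] TraceClass (n × n)) := .restrictScalars ℚ ℂ _
  have := NormedSpace.map_exp f hc (LinearMap.toMatrixAlgEquiv (Matrix.stdBasis ℂ n n) Φ)
  simpa [hf, superExp] using this

lemma IsLindbladian.norm_exp_diamondAlgHom_le_one {Φ : Superoperator n} (hΦ : IsLindbladian Φ)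
    {s : ℝ} (hs : 0 ≤ s) : ‖NormedSpace.exp (s • diamondAlgHom n Φ)‖ ≤ 1 := by
  obtain ⟨c, hc, h⟩ := (hΦ.ampliation (a := n)).exists_traceNorm_add_smul_le
  refine norm_exp_smul_le_one_of_norm_one_add_smul_le
    (𝔸 := TraceClass (n × n) →L[ℂ] TraceClass (n × n)) (c := c) (fun ε hε => ?_) hs
  exact ContinuousLinearMap.opNorm_le_bound _ (by positivity) (h ε hε)

end DiamondNorm

theorem mainTheorem2 {n : Type*} [Fintype n] [DecidableEq n] (m : ℕ)
    (L : Fin m → Superoperator n) (hL : ∀ j, IsLindbladian (L j)) (t : ℝ) (ht : 0 < t) :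
    diamondNorm (productFormula L t - superExp (t • ∑ j, L j)) ≤
      t ^ 3 / 12 *
          ∑ j₁, diamondNorm
            ⁅∑ j₃ ∈ Finset.Ioi j₁, L j₃, ⁅∑ j₂ ∈ Finset.Ioi j₁, L j₂, L j₁⁆⁆ +
        t ^ 3 / 24 *
          ∑ j₁, diamondNorm ⁅L j₁, ⁅L j₁, ∑ j₂ ∈ Finset.Ioi j₁, L j₂⁆⁆ := by
  have hsmul (r : ℝ) (Φ : Superoperator n) : diamondAlgHom n (r • Φ) = r • diamondAlgHom n Φ :=
    map_smul (diamondAlgHom n) (r : ℂ) Φ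
  -- Every partial sum of the `L j` is a Lindbladian, hence generates a contraction semigroup.
  have key := norm_symmetric_product_sub_exp_le (fun j => diamondAlgHom n (L j))
    (fun S s hs => by
      rw [← map_sum]
      exact (IsLindbladian.sum fun j _ => hL j).norm_exp_diamondAlgHom_le_one hs) ht.le
  simp only [diamondNorm_eq_norm, productFormula, map_sub, map_mul, map_list_prod, List.map_ofFn,
    List.map_reverse, diamondAlgHom_superExp, hsmul, map_sum, Ring.lie_def, Function.comp_def]
  simpa only [Ring.lie_def] using key
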